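/- Let $n\in\mathbb N$, $T>0$, and let $A:\mathbb R\to\mathbb R^{n\times n}$ be continuous and $T$-periodic. Consider the linear system $$\dot{\mathbf x}=A(t)\,\mathbf x,\qquad \mathbf x\in\mathbb R^n. \tag{1}$$ A fundamental matrix solution of (1) is a differentiable function $\Phi:\mathbb R\to\mathbb R^{n\times n}$ with $\dot\Phi(t)=A(t)\Phi(t)$ and $\Phi(t)$ invertible for all $t\in\mathbb R$; the matrix $\Phi(0)^{-1}\Phi(T)$ is then called a monodromy matrix of (1), and its (complex) Jordan normal form does not depend on the choice of $\Phi$, up to the order of the blocks. The A-index (antiperiodicity index) of (1) is the sum of the dimensions of those Jordan blocks associated to a real negative eigenvalue that appear an odd number of times in the Jordan normal form of a monodromy matrix of (1), where a block that appears several times is counted only once. Then the following statements are equivalent: (a) The A-index of (1) is zero. (b) There are $R\in\mathbb R^{n\times n}$ and a $T$-periodic function $Q:\mathbb R\to\mathbb R^{n\times n}$ such that $\Psi(t):=Q(t)e^{tR}$ is a fundamental matrix solution of (1). (c) For every fundamental matrix solution $\Phi$ of (1) there are $B\in\mathbb R^{n\times n}$ and a $T$-periodic function $P:\mathbb R\to\mathbb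 R^{n\times n}$ such that $\Phi(t)=P(t)e^{tB}$ for all $t\in\mathbb R$. -/

import Mathlib

namespace Floquet

/-- `Φ` is a (real) fundamental matrix solution of `x' = A(t) x`, `x ∈ ℝⁿ`: its columns are
solutions and they are linearly independent at every time. -/
def IsFundamentalMatrixSolution {n : ℕ} (A Φ : ℝ → Matrix (Fin n) (Fin n) ℝ) : Prop :=
  (∀ t : ℝ, HasDerivAt Φ (A t * Φ t) t) ∧ ∀ t : ℝ, IsUnit (Φ t)

/-- The monodromy matrix `Φ(0)⁻¹ Φ(T)` associated with a fundamental matrix solution `Φ`. -/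
noncomputable def monodromyMatrix {n : ℕ} (Φ : ℝ → Matrix (Fin n) (Fin n) ℝ) (T : ℝ) :
    Matrix (Fin n) (Fin n) ℝ :=
  (Φ 0)⁻¹ * Φ T

/-- The `m × m` Jordan block with eigenvalue `μ`: `μ` on the diagonal, `1` on the
superdiagonal and `0` elsewhere. -/
def jordanBlock (m : ℕ) (μ : ℂ) : Matrix (Fin m) (Fin m) ℂ :=
  Matrix.of fun i j => if i = j then μ else if (i : ℕ) + 1 = (j : ℕ) then 1 else 0

/-- A finite sequence of Jordan blocks, given by their (positive) sizes and eigenvalues. -/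
structure JordanBlocks where
  numBlocks : ℕ
  size : Fin numBlocks → ℕ
  size_pos : ∀ l, 0 < size l
  eigenvalue : Fin numBlocks → ℂ

/-- The direct sum of the Jordan blocks of `J`. -/
def JordanBlocks.toMatrix (J : JordanBlocks) :
    Matrix ((l : Fin J.numBlocks) × Fin (J.size l)) ((l : Fin J.numBlocks) × Fin (J.size l)) ℂ :=
  Matrix.blockDiagonal' fun l => jordanBlock (J.size l) (J.eigenvalue l)

/-- `J` is the list of blocks of a Jordan normal form of the real matrix `M`: over `ℂ`, `M` is
similar to the direct sum of the blocks of `J` (the index set of the direct sum being identified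
with `Fin n` through some bijection). -/
def JordanBlocks.IsNormalFormOf (J : JordanBlocks) {n : ℕ} (M : Matrix (Fin n) (Fin n) ℝ) : Prop :=
  ∃ (e : ((l : Fin J.numBlocks) × Fin (J.size l)) ≃ Fin n) (S : Matrix (Fin n) (Fin n) ℂ),
    IsUnit S ∧ S⁻¹ * M.map Complex.ofReal * S = Matrix.reindex e e J.toMatrix

/-- The number of times that the `m × m` Jordan block with eigenvalue `μ` appears in `J`. -/
noncomputable def JordanBlocks.multiplicity (J : JordanBlocks) (m : ℕ) (μ : ℂ) : ℕ :=
  (Finset.univ.filter fun l => J.size l = m ∧ J.eigenvalue l = μ).card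

open Classical in
/-- The set of pairs (size, eigenvalue) of the different Jordan blocks which are associated with
a real negative eigenvalue and appear an odd number of times in `J`. -/
noncomputable def JordanBlocks.oddNegativeBlocks (J : JordanBlocks) : Finset (ℕ × ℂ) :=
  (Finset.univ.image fun l => (J.size l, J.eigenvalue l)).filter fun p =>
    (∃ r : ℝ, r < 0 ∧ p.2 = (r : ℂ)) ∧ Odd (J.multiplicity p.1 p.2)

/-- The sum of the dimensions of the Jordan blocks associated with a real negative eigenvalue
that appear an odd number of times in `J`, each one counted only once. -/
noncomputable def JordanBlocks.oddNegativeDim (J : JordanBlocks) : ℕ :=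
  ∑ p ∈ J.oddNegativeBlocks, p.1

/-- `d` is obtained as in the definition of the A-index of the `T`-periodic system `x' = A(t) x`,
from some fundamental matrix solution and some Jordan normal form of its monodromy matrix. -/
def IsAIndex {n : ℕ} (A : ℝ → Matrix (Fin n) (Fin n) ℝ) (T : ℝ) (d : ℕ) : Prop :=
  ∃ (Φ : ℝ → Matrix (Fin n) (Fin n) ℝ) (J : JordanBlocks),
    IsFundamentalMatrixSolution A Φ ∧ J.IsNormalFormOf (monodromyMatrix Φ T) ∧
      d = J.oddNegativeDim

/-- The antiperiodicity index (A-index) of the `T`-periodic system `x' = A(t) x`. Monodromy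
matrices of the system are similar to each other and the Jordan normal form is unique up to the
order of the blocks, so that for a continuous `T`-periodic `A` exactly one `d` satisfies
`IsAIndex A T d`, and `sInf` picks this number. -/
noncomputable def aIndex {n : ℕ} (A : ℝ → Matrix (Fin n) (Fin n) ℝ) (T : ℝ) : ℕ :=
  sInf {d : ℕ | IsAIndex A T d}

end Floquet

/-! Everything reduces to one matrix question: a monodromy matrix `M` satisfies `Φ (t + T) = Φ t *
M`, so a real Floquet factorization of `Φ` with exponent `B` exists exactly when `exp (T • B) = M`.
The claim is therefore Culver's criterion: an invertible real `M` has a real logarithm iff every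
Jordan block with negative eigenvalue occurs an even number of times.

Necessity: a real logarithm gives a real square root `N` of `M`. On `W = ker (N² - r)^k` with `r <
0`, the restriction of `N²` is `r` minus a nilpotent map, so `det (N|W)² = r ^ dim W` and `dim W` is
even (`even_finrank_ker_of_mul_self`). Block multiplicities are second differences of these
dimensions, hence even.

Sufficiency: since `M` is real, blocks for `μ` and its conjugate are equally frequent; together with
the parity hypothesis this yields an involution on the blocks whose fixed points have positive real
eigenvalue (`exists_involution_lift`). Conjugate logarithms are put on paired blocks and real ones
on fixed blocks (`exists_blockwise_log`). The resulting block matrix is conjugated by a permutation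
of indices into its complex conjugate, hence is similar to a real `B`
(`exists_similar_real_of_conj_eq_submatrix`). Then `exp B` and `M` are similar over `ℂ`, so over `ℝ`
(`exists_real_similarity`), and conjugating `B` gives the logarithm. -/

namespace Floquet

open Polynomial

/-! ### Global solutions of linear equations by the Picard series. -/

section LinearODE

variable {E : Type*} [NormedAddCommGroup E] [NormedSpace ℝ E]

theorem norm_integral_le_of_norm_le_mul_abs_pow {f : ℝ → E} {C a : ℝ} {k : ℕ}
    (hf : ∀ s, |s| ≤ a → ‖f s‖ ≤ C * |s| ^ k) {t : ℝ} (ht : |t| ≤ a) :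
    ‖∫ s in (0 : ℝ)..t, f s‖ ≤ C * |t| ^ (k + 1) / (k + 1) := by
  have key : ∀ g : ℝ → E, (∀ s, |s| ≤ a → ‖g s‖ ≤ C * |s| ^ k) → ∀ t, 0 ≤ t → t ≤ a →
      ‖∫ s in (0 : ℝ)..t, g s‖ ≤ C * t ^ (k + 1) / (k + 1) := by
    intro g hg t ht0 hta
    have h1 : ‖∫ s in (0 : ℝ)..t, g s‖ ≤ ∫ s in (0 : ℝ)..t, C * s ^ k := by
      refine intervalIntegral.norm_integral_le_of_norm_le ht0 ?_
        (Continuous.intervalIntegrable (by fun_prop) _ _)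
      refine Filter.Eventually.of_forall fun s hs => ?_
      have := hg s (by rw [abs_of_pos hs.1]; exact hs.2.trans hta)
      rwa [abs_of_pos hs.1] at this
    refine h1.trans_eq ?_
    rw [intervalIntegral.integral_const_mul, integral_pow]
    simp [mul_div_assoc]
  rcases le_total 0 t with h | h
  · rw [abs_of_nonneg h] at ht ⊢
    exact key f hf t h ht
  · rw [abs_of_nonpos h] at ht ⊢
    have := key (fun s => f (-s)) (fun s hs => by simpa using hf (-s) (by simpa using hs)) (-t)
      (by linarith) ht
    rw [intervalIntegral.integral_comp_neg, intervalIntegral.integral_symm, norm_neg] at this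
    simpa using this

/-- The terms of the Picard series of the linear equation `x' = L(t) x`, `x(0) = x₀`. -/
noncomputable def picardTerm (L : ℝ → E →L[ℝ] E) (x₀ : E) : ℕ → ℝ → E
  | 0 => fun _ => x₀
  | k + 1 => fun t => ∫ s in (0 : ℝ)..t, L s (picardTerm L x₀ k s)

theorem continuous_picardTerm {L : ℝ → E →L[ℝ] E} (hL : Continuous L) (x₀ : E) (k : ℕ) :
    Continuous (picardTerm L x₀ k) := by
  induction k with
  | zero => exact continuous_const
  | succ k ih =>
    exact intervalIntegral.continuous_primitive
      (fun a b => (hL.clm_apply ih).intervalIntegrable a b) 0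

theorem hasDerivAt_picardTerm_succ [CompleteSpace E] {L : ℝ → E →L[ℝ] E} (hL : Continuous L) (x₀ : E) (k : ℕ)
    (t : ℝ) : HasDerivAt (picardTerm L x₀ (k + 1)) (L t (picardTerm L x₀ k t)) t :=
  ((hL.clm_apply (continuous_picardTerm hL x₀ k)).integral_hasStrictDerivAt 0 t).hasDerivAt

theorem norm_picardTerm_le {L : ℝ → E →L[ℝ] E} {x₀ : E} {K a : ℝ}
    (hK : ∀ s, |s| ≤ a → ‖L s‖ ≤ K) (hK0 : 0 ≤ K) (k : ℕ) {t : ℝ} (ht : |t| ≤ a) :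
    ‖picardTerm L x₀ k t‖ ≤ ‖x₀‖ * K ^ k / k.factorial * |t| ^ k := by
  induction k generalizing t with
  | zero => simp [picardTerm]
  | succ k ih =>
    have := norm_integral_le_of_norm_le_mul_abs_pow (f := fun s => L s (picardTerm L x₀ k s))
      (C := K * (‖x₀‖ * K ^ k / k.factorial)) (k := k) (a := a) (t := t) ?_ ht
    · refine this.trans_eq ?_
      rw [Nat.factorial_succ]
      push_cast
      field_simp
      ring
    · intro s hs
      refine ((L s).le_opNorm _).trans ?_
      rw [mul_assoc]
      exact mul_le_mul (hK s hs) (ih hs) (norm_nonneg _) hK0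

variable [CompleteSpace E]

/-- The factorial bound makes the Picard series and its termwise derivative converge uniformly on
every bounded interval, so linearity gives a global solution with no continuation argument. -/
theorem exists_hasDerivAt_linear {L : ℝ → E →L[ℝ] E} (hL : Continuous L) (x₀ : E) :
    ∃ x : ℝ → E, x 0 = x₀ ∧ ∀ t, HasDerivAt x (L t (x t)) t := by
  have hbd : ∀ a : ℝ, ∃ K, 0 ≤ K ∧ ∀ s, |s| ≤ a → ‖L s‖ ≤ K := by
    intro a
    obtain ⟨K, hK⟩ := (isCompact_Icc (a := -a) (b := a)).exists_bound_of_continuousOn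
      hL.continuousOn
    exact ⟨max K 0, le_max_right _ _,
      fun s hs => (hK s ⟨(abs_le.1 hs).1, (abs_le.1 hs).2⟩).trans (le_max_left _ _)⟩
  have hsum : ∀ a : ℝ, 0 ≤ a → ∃ u : ℕ → ℝ, Summable u ∧ ∀ k t, |t| ≤ a →
      ‖picardTerm L x₀ k t‖ ≤ u k := by
    intro a ha
    obtain ⟨K, hK0, hK⟩ := hbd a
    refine ⟨fun k => ‖x₀‖ * ((K * a) ^ k / k.factorial),
      (Real.summable_pow_div_factorial _).mul_left _, fun k t ht => ?_⟩
    refine (norm_picardTerm_le hK hK0 k ht).trans ?_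
    have : |t| ^ k ≤ a ^ k := pow_le_pow_left₀ (abs_nonneg _) ht k
    calc ‖x₀‖ * K ^ k / k.factorial * |t| ^ k ≤ ‖x₀‖ * K ^ k / k.factorial * a ^ k := by gcongr
      _ = ‖x₀‖ * ((K * a) ^ k / k.factorial) := by rw [mul_pow]; ring
  refine ⟨fun t => ∑' k, picardTerm L x₀ k t, ?_, fun t => ?_⟩
  · beta_reduce
    rw [tsum_eq_single 0]
    · rfl
    · rintro (_ | k) hk
      · exact absurd rfl hk
      · simp [picardTerm]
  -- The radius `|t| + 1` puts `t` in the interior of the interval of uniform convergence.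
  · obtain ⟨u, hu, hu'⟩ := hsum (|t| + 1) (by positivity)
    obtain ⟨K, hK0, hK⟩ := hbd (|t| + 1)
    have hs : ∀ s, |s| ≤ |t| + 1 → Summable fun k => picardTerm L x₀ k s := fun s hs =>
      Summable.of_norm_bounded hu fun k => hu' k s hs
    have hmem : t ∈ Set.Ioo (-(|t| + 1)) (|t| + 1) := by
      rw [Set.mem_Ioo, ← abs_lt]; linarith
    have h1 : HasDerivAt (fun s => ∑' k, picardTerm L x₀ (k + 1) s)
        (∑' k, L t (picardTerm L x₀ k t)) t := by
      refine hasDerivAt_tsum_of_isPreconnected (hu.mul_left K) isOpen_Ioo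
        (isPreconnected_Ioo (a := -(|t| + 1)) (b := |t| + 1))
        (fun k s _ => hasDerivAt_picardTerm_succ hL x₀ k s) (fun k s hs' => ?_) hmem
        ((summable_nat_add_iff 1).2 (hs t (by linarith))) hmem
      have : |s| ≤ |t| + 1 := (abs_lt.2 hs').le
      exact ((L s).le_opNorm _).trans
        (mul_le_mul (hK s this) (hu' k s this) (norm_nonneg _) hK0)
    rw [← (L t).map_tsum (hs t (by linarith))] at h1
    refine (h1.const_add x₀).congr_of_eventuallyEq ?_
    filter_upwards [isOpen_Ioo.mem_nhds hmem] with s hs'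
    rw [(hs s (abs_lt.2 hs').le).tsum_eq_zero_add]
    rfl

end LinearODE

/-! ### Fundamental matrix solutions. -/

section Fundamental

variable {n : ℕ} {A : ℝ → Matrix (Fin n) (Fin n) ℝ}

open scoped Matrix.Norms.Operator in
/-- Global existence for the matrix equation, together with the inverse of its solution; every
other solution is a constant multiple of this one. -/
theorem exists_fundamental_and_unique (hA : Continuous A) :
    ∃ Φ : ℝ → Matrix (Fin n) (Fin n) ℝ, IsFundamentalMatrixSolution A Φ ∧ Φ 0 = 1 ∧
      ∀ X : ℝ → Matrix (Fin n) (Fin n) ℝ, (∀ t, HasDerivAt X (A t * X t) t) →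
        ∀ t, X t = Φ t * X 0 := by
  obtain ⟨Φ, hΦ0, hΦ⟩ := exists_hasDerivAt_linear
    (L := fun t => ContinuousLinearMap.mul ℝ (Matrix (Fin n) (Fin n) ℝ) (A t)) (by fun_prop) 1
  -- `Ψ` solves the adjoint equation `Ψ' = -Ψ A`, so `Ψ X` is constant for every solution `X`. This
  -- gives both the invertibility of `Φ` and uniqueness.
  obtain ⟨Ψ, hΨ0, hΨ⟩ := exists_hasDerivAt_linear
    (L := fun t => (ContinuousLinearMap.mul ℝ (Matrix (Fin n) (Fin n) ℝ)).flip (-A t))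
    (by fun_prop) 1
  simp only [ContinuousLinearMap.mul_apply', ContinuousLinearMap.flip_apply] at hΦ hΨ
  have hconst : ∀ X : ℝ → Matrix (Fin n) (Fin n) ℝ, (∀ t, HasDerivAt X (A t * X t) t) →
      ∀ t, Ψ t * X t = X 0 := by
    intro X hX t
    have hd : ∀ s, HasDerivAt (fun s => Ψ s * X s) 0 s := fun s => by
      have h := (hΨ s).mul (hX s)
      rwa [show Ψ s * -A s * X s + Ψ s * (A s * X s) = 0 by
        rw [mul_neg, neg_mul, mul_assoc, neg_add_cancel]] at h
    have := is_const_of_deriv_eq_zero (fun s => (hd s).differentiableAt)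
      (fun s => (hd s).deriv) t 0
    simpa [hΨ0] using this
  have hΨΦ : ∀ t, Ψ t * Φ t = 1 := fun t => (hconst Φ hΦ t).trans hΦ0
  have hΦΨ : ∀ t, Φ t * Ψ t = 1 := fun t => mul_eq_one_comm.1 (hΨΦ t)
  refine ⟨Φ, ⟨hΦ, fun t => IsUnit.of_mul_eq_one _ (hΦΨ t)⟩, hΦ0, fun X hX t => ?_⟩
  rw [← hconst X hX t, ← mul_assoc, hΦΨ, one_mul]

end Fundamental

/-! ### Logarithms of unipotent matrices. -/

section Log

variable {𝕂 : Type*} [RCLike 𝕂] {m : Type*} [Fintype m] [DecidableEq m]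

theorem exp_eq_sum_of_pow_eq_zero {a : Matrix m m 𝕂} {k : ℕ} (ha : a ^ k = 0) :
    NormedSpace.exp a = ∑ i ∈ Finset.range k, ((i.factorial : 𝕂)⁻¹) • a ^ i := by
  rw [NormedSpace.exp_eq_tsum 𝕂]
  refine tsum_eq_sum fun i hi => ?_
  rw [pow_eq_zero_of_le (by simpa using hi) ha, smul_zero]

/-- For nilpotent `a`, the matrix `1 + a` has a logarithm which is a polynomial in `a`. -/
theorem exists_exp_aeval_eq_one_add (k : ℕ) (a : Matrix m m 𝕂) (ha : a ^ k = 0) :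
    ∃ l : 𝕂[X], NormedSpace.exp (aeval a l) = 1 + a := by
  induction k using Nat.strong_induction_on generalizing a with
  | _ k ih =>
    rcases Nat.lt_or_ge k 2 with hk | hk
    · have ha0 : a = 0 := by simpa using pow_eq_zero_of_le (Nat.le_of_lt_succ hk) ha
      exact ⟨0, by simp [ha0, NormedSpace.exp_zero]⟩
    -- Here `p` is the truncated series of `exp (-X)`, and `p * (1 + X) ≡ 1` modulo `X ^ 2`. Hence
    -- `1 + a = exp a * (1 + b)` with `b` a polynomial multiple of `a ^ 2`, whose nilpotency
    -- exponent is about half of `k`; induction supplies a logarithm of `1 + b` commuting with `a`.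
    · set p : 𝕂[X] := ∑ i ∈ Finset.range k, C ((i.factorial : 𝕂)⁻¹) * (-X) ^ i with hp
      have hpa : NormedSpace.exp (-a) = aeval a p := by
        rw [exp_eq_sum_of_pow_eq_zero (k := k) (by rw [neg_pow, ha, mul_zero]), hp]
        simp [map_sum, ← Algebra.smul_def]
      obtain ⟨q, hq⟩ : X ^ 2 ∣ p * (1 + X) - 1 := by
        obtain ⟨j, rfl⟩ := Nat.exists_eq_add_of_le' hk
        have : p = 1 - X + X ^ 2 *
            ∑ i ∈ Finset.range j, C (((i + 2).factorial : 𝕂)⁻¹) * (-X) ^ i := by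
          rw [hp, Finset.sum_range_succ', Finset.sum_range_succ', Finset.mul_sum]
          simp only [Nat.factorial, zero_add, pow_zero, pow_one]
          simp only [Nat.cast_one, mul_one, inv_one, map_one, one_mul]
          rw [add_assoc, add_comm]
          congr 1
          · ring
          · exact Finset.sum_congr rfl fun i _ => by ring
        rw [this]
        exact ⟨-1 + (∑ i ∈ Finset.range j, C (((i + 2).factorial : 𝕂)⁻¹) * (-X) ^ i) * (1 + X),
          by ring⟩
      set b : Matrix m m 𝕂 := aeval a (X ^ 2 * q) with hb
      have hb1 : NormedSpace.exp (-a) * (1 + a) = 1 + b := by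
        rw [hb, ← hq, hpa]; simp
      have hbk : b ^ ((k + 1) / 2) = 0 := by
        rw [hb, ← map_pow, mul_pow, ← pow_mul, map_mul, map_pow, aeval_X,
          pow_eq_zero_of_le (by omega) ha, zero_mul]
      obtain ⟨l, hl⟩ := ih _ (by omega) b hbk
      refine ⟨X + l.comp (X ^ 2 * q), ?_⟩
      have hlb : aeval a (l.comp (X ^ 2 * q)) = aeval b l := by rw [aeval_comp]
      have hc : Commute a (aeval b l) := by
        have := (Commute.all (X : 𝕂[X]) (l.comp (X ^ 2 * q))).map (aeval a)
        rwa [aeval_X, hlb] at this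
      have h1 := Matrix.exp_add_of_commute a (aeval b l) hc
      have h2 := Matrix.exp_add_of_commute a (-a) (Commute.refl a).neg_right
      rw [add_neg_cancel, NormedSpace.exp_zero] at h2
      rw [map_add, hlb, aeval_X, h1, hl, ← hb1, ← mul_assoc, ← h2, one_mul]

end Log

/-! ### Logarithms of single Jordan blocks. -/

section Shift

/-- The nilpotent Jordan block. -/
def shiftMatrix (R : Type*) [Zero R] [One R] (m : ℕ) : Matrix (Fin m) (Fin m) R :=
  Matrix.of fun i j => if (i : ℕ) + 1 = j then 1 else 0

theorem shiftMatrix_pow_apply {R : Type*} [CommRing R] {m : ℕ} (k : ℕ) (i j : Fin m) :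
    (shiftMatrix R m ^ k) i j = if (i : ℕ) + k = j then 1 else 0 := by
  induction k generalizing i with
  | zero => simp [Matrix.one_apply, Fin.ext_iff]
  | succ k ih =>
    rw [pow_succ', Matrix.mul_apply]
    simp only [ih]
    simp only [shiftMatrix, Matrix.of_apply, ite_mul, one_mul, zero_mul]
    by_cases h : (i : ℕ) + 1 < m
    · rw [Finset.sum_eq_single (⟨i + 1, h⟩ : Fin m)]
      · simp [add_assoc, add_comm 1 k]
      · intro b _ hb
        rw [if_neg]
        exact fun h' => hb (Fin.ext h'.symm)
      · simp
    · have hj := j.2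
      rw [if_neg (by omega)]
      refine Finset.sum_eq_zero fun b _ => if_neg ?_
      have := b.2
      omega

theorem shiftMatrix_pow_self {R : Type*} [CommRing R] (m : ℕ) : shiftMatrix R m ^ m = 0 := by
  ext i j
  have := j.2
  rw [shiftMatrix_pow_apply, if_neg (by omega), Matrix.zero_apply]

theorem jordanBlock_eq (m : ℕ) (μ : ℂ) : jordanBlock m μ = μ • 1 + shiftMatrix ℂ m := by
  ext i j
  simp only [jordanBlock, shiftMatrix, Matrix.of_apply, Matrix.add_apply, Matrix.smul_apply,
    Matrix.one_apply, smul_eq_mul, mul_ite, mul_one, mul_zero]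
  split_ifs with h1 h2
  · subst h1; omega
  all_goals simp

/-- Factor `μ + N = μ (1 + μ⁻¹ N)` and add the scalar logarithm `z` to that of the unipotent factor.
Working over `RCLike` covers complex blocks and real blocks with positive eigenvalue together. -/
theorem exists_exp_eq_smul_one_add_shiftMatrix {𝕂 : Type*} [RCLike 𝕂] (m : ℕ) {z μ : 𝕂}
    (hz : NormedSpace.exp z = μ) :
    ∃ L : Matrix (Fin m) (Fin m) 𝕂, NormedSpace.exp L = μ • 1 + shiftMatrix 𝕂 m := by
  have hμ : μ ≠ 0 := by
    rw [← hz]; exact (NormedSpace.isUnit_exp z).ne_zero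
  obtain ⟨l, hl⟩ := exists_exp_aeval_eq_one_add m (μ⁻¹ • shiftMatrix 𝕂 m)
    (by rw [_root_.smul_pow, shiftMatrix_pow_self, smul_zero])
  refine ⟨Matrix.diagonal (fun _ => z) + aeval (μ⁻¹ • shiftMatrix 𝕂 m) l, ?_⟩
  have hd : ∀ w : 𝕂, Matrix.diagonal (fun _ : Fin m => w) = w • 1 := fun w => by
    rw [Matrix.smul_one_eq_diagonal]
  rw [Matrix.exp_add_of_commute, hl, Matrix.exp_diagonal]
  · have : NormedSpace.exp (fun _ : Fin m => z) = fun _ => μ := by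
      ext i; rw [Pi.coe_exp, hz]
    rw [this, hd, smul_one_mul, smul_add, smul_smul, mul_inv_cancel₀ hμ, one_smul]
  · rw [hd]; exact (Commute.one_left _).smul_left _

theorem exists_exp_eq_jordanBlock (m : ℕ) {μ : ℂ} (hμ : μ ≠ 0) :
    ∃ L : Matrix (Fin m) (Fin m) ℂ, NormedSpace.exp L = jordanBlock m μ := by
  rw [jordanBlock_eq]
  refine exists_exp_eq_smul_one_add_shiftMatrix m (z := Complex.log μ) ?_
  rw [← Complex.exp_eq_exp_ℂ, Complex.exp_log hμ]

theorem exp_map_ofReal {m : Type*} [Fintype m] [DecidableEq m] (L : Matrix m m ℝ) :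
    NormedSpace.exp (L.map Complex.ofReal) = (NormedSpace.exp L).map Complex.ofReal := by
  have hc : Continuous (Complex.ofRealHom.mapMatrix (m := m)) := by
    change Continuous fun M : Matrix m m ℝ => M.map Complex.ofReal
    exact continuous_id.matrix_map Complex.continuous_ofReal
  open scoped Matrix.Norms.Operator in
  exact (NormedSpace.map_exp (Complex.ofRealHom.mapMatrix (m := m)) hc L).symm

theorem exp_map_conj {m : Type*} [Fintype m] [DecidableEq m] (L : Matrix m m ℂ) :
    NormedSpace.exp (L.map (starRingEnd ℂ)) = (NormedSpace.exp L).map (starRingEnd ℂ) := by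
  have hc : Continuous ((starRingEnd ℂ).mapMatrix (m := m)) := by
    change Continuous fun M : Matrix m m ℂ => M.map (starRingEnd ℂ)
    exact continuous_id.matrix_map Complex.continuous_conj
  open scoped Matrix.Norms.Operator in
  exact (NormedSpace.map_exp ((starRingEnd ℂ).mapMatrix (m := m)) hc L).symm

theorem exists_real_exp_eq_jordanBlock (m : ℕ) {r : ℝ} (hr : 0 < r) :
    ∃ L : Matrix (Fin m) (Fin m) ℝ,
      NormedSpace.exp (L.map Complex.ofReal) = jordanBlock m r := by
  obtain ⟨L, hL⟩ := exists_exp_eq_smul_one_add_shiftMatrix m (𝕂 := ℝ) (z := Real.log r) (μ := r)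
    (by rw [← Real.exp_eq_exp_ℝ, Real.exp_log hr])
  refine ⟨L, ?_⟩
  rw [exp_map_ofReal, hL, jordanBlock_eq]
  ext i j
  simp only [shiftMatrix, Matrix.map_apply, Matrix.add_apply, Matrix.smul_apply, Matrix.one_apply,
    Matrix.of_apply]
  split_ifs <;> simp

end Shift

/-! ### Existence of the Jordan normal form. -/

/-- Up to a unit `p = X - μ`. The classes of `(X - μ) ^ (e - 1 - j)` span by Taylor expansion at
`μ`, and there are as many as the dimension. The exponents decrease so that multiplication by `X -
μ` sends the `j`-th vector to the preceding one, which puts the ones on the superdiagonal. -/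
theorem exists_basis_quotient_pow_irreducible {p : ℂ[X]} (hp : Irreducible p) (e : ℕ) :
    ∃ (μ : ℂ) (b : Module.Basis (Fin e) ℂ (ℂ[X] ⧸ Submodule.span ℂ[X] {p ^ e})),
      ∀ j, (X : ℂ[X]) • b j = ∑ i, jordanBlock e μ i j • b i := by
  obtain ⟨μ, hμ⟩ := IsAlgClosed.exists_root p
    (by rw [IsAlgClosed.degree_eq_one_of_irreducible ℂ hp]; exact one_ne_zero)
  have hassoc : Associated (X - C μ) p :=
    (irreducible_X_sub_C μ).associated_of_dvd hp (dvd_iff_isRoot.2 hμ)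
  have hnd : (p ^ e).natDegree = e := by
    have h1 : p.natDegree = 1 :=
      natDegree_eq_of_degree_eq_some (IsAlgClosed.degree_eq_one_of_irreducible ℂ hp)
    rw [natDegree_pow, h1, mul_one]
  set mk : ℂ[X] →ₗ[ℂ[X]] (ℂ[X] ⧸ Submodule.span ℂ[X] {p ^ e}) := Submodule.mkQ _ with hmk
  have hzero : ∀ k, e ≤ k → mk ((X - C μ) ^ k) = 0 := fun k hk => by
    rw [hmk, Submodule.mkQ_apply, Submodule.Quotient.mk_eq_zero, ← Ideal.submodule_span_eq.symm,
      Ideal.mem_span_singleton]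
    exact (hassoc.symm.pow_pow (n := e)).dvd.trans (pow_dvd_pow _ hk)
  set v : Fin e → ℂ[X] ⧸ Submodule.span ℂ[X] {p ^ e} :=
    fun j => mk ((X - C μ) ^ (e - 1 - (j : ℕ))) with hv
  have hspan : ⊤ ≤ Submodule.span ℂ (Set.range v) := by
    rintro x -
    obtain ⟨q, rfl⟩ := Submodule.mkQ_surjective _ x
    rw [← sum_taylor_eq q μ, Polynomial.sum, map_sum]
    refine Submodule.sum_mem _ fun k _ => ?_
    rw [← smul_eq_C_mul, ← algebraMap_smul ℂ[X], map_smul, algebraMap_smul]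
    refine Submodule.smul_mem _ _ ?_
    rcases lt_or_ge k e with h | h
    · refine Submodule.subset_span ⟨⟨e - 1 - k, by omega⟩, ?_⟩
      simp only [hv, hmk]
      congr 2
      omega
    · have := hzero k h
      rw [hmk] at this
      rw [this]
      exact Submodule.zero_mem _
  have hcard : Fintype.card (Fin e) =
      Module.finrank ℂ (ℂ[X] ⧸ Submodule.span ℂ[X] {p ^ e}) := by
    rw [Fintype.card_fin]
    exact hnd.symm.trans (finrank_quotient_span_eq_natDegree (f := p ^ e)).symm
  refine ⟨μ, basisOfTopLeSpanOfCardEqFinrank v hspan hcard, fun j => ?_⟩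
  simp only [coe_basisOfTopLeSpanOfCardEqFinrank]
  have hX : (X : ℂ[X]) • v j = μ • v j + mk ((X - C μ) ^ (e - 1 - (j : ℕ) + 1)) := by
    have h1 : μ • v j = (C μ : ℂ[X]) • v j := by
      rw [← algebraMap_smul ℂ[X] μ (v j)]; rfl
    rw [h1, hv]
    simp only
    rw [← map_smul, ← map_smul, ← map_add]
    congr 1
    rw [smul_eq_mul, smul_eq_mul]
    ring
  rw [hX]
  have hj := j.2
  have hsplit : ∀ i, jordanBlock e μ i j • v i =
      (if i = j then μ • v j else 0) + if (i : ℕ) + 1 = j then v i else 0 := by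
    intro i
    simp only [jordanBlock, Matrix.of_apply]
    split_ifs with h1 h2
    · subst h1; omega
    · subst h1; simp
    · simp
    · simp
  rw [Finset.sum_congr rfl fun i _ => hsplit i, Finset.sum_add_distrib]
  simp only [Finset.sum_ite_eq', Finset.mem_univ, if_true]
  congr 1
  rcases Nat.eq_zero_or_pos (j : ℕ) with h | h
  · rw [hzero _ (by omega)]
    exact (Finset.sum_eq_zero fun i _ => if_neg (by omega)).symm
  · rw [Finset.sum_eq_single (⟨(j : ℕ) - 1, by omega⟩ : Fin e)]
    · rw [if_pos (by simp only; omega), hv]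
      simp only
      congr 2
      omega
    · intro b _ hb
      exact if_neg fun h' => hb (Fin.ext (by simp only; omega))
    · simp

theorem exists_isNormalForm_of_basis {n : ℕ} (M : Matrix (Fin n) (Fin n) ℝ) {ι : Type}
    [Fintype ι] (size : ι → ℕ) (μ : ι → ℂ)
    (b : Module.Basis ((i : ι) × Fin (size i)) ℂ (Fin n → ℂ))
    (hb : ∀ i j, (M.map Complex.ofReal).mulVec (b ⟨i, j⟩) =
      ∑ k, jordanBlock (size i) (μ i) k j • b ⟨i, k⟩) :
    ∃ J : JordanBlocks, J.IsNormalFormOf M := by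
  classical
  -- The torsion decomposition may contain factors with exponent `0`; these empty blocks are
  -- discarded, since `JordanBlocks` requires positive sizes.
  let c : {i // 0 < size i} ≃ Fin (Fintype.card {i // 0 < size i}) := Fintype.equivFin _
  let J : JordanBlocks :=
    { numBlocks := Fintype.card {i // 0 < size i}
      size := fun l => size (c.symm l).1
      size_pos := fun l => (c.symm l).2
      eigenvalue := fun l => μ (c.symm l).1 }
  let φ : ((l : Fin J.numBlocks) × Fin (J.size l)) → (i : ι) × Fin (size i) :=
    fun x => ⟨(c.symm x.1).1, x.2⟩
  have hφ : Function.Bijective φ := by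
    constructor
    · rintro ⟨l, k⟩ ⟨l', k'⟩ h
      have h1 : l = l' := c.symm.injective (Subtype.ext (congrArg Sigma.fst h))
      subst h1
      simpa [φ] using h
    · rintro ⟨i, k⟩
      have hi : 0 < size i := k.pos
      refine ⟨⟨c ⟨i, hi⟩, Fin.cast (by simp [J]) k⟩, ?_⟩
      have h0 : (c.symm (c ⟨i, hi⟩)).1 = i := by simp
      simp only [φ]
      refine Sigma.ext h0 ?_
      rw [Fin.heq_ext_iff (congrArg size h0)]
      simp
  let b' := b.reindex (Equiv.ofBijective φ hφ).symm
  have hb' : ∀ x, b' x = b (φ x) := fun x => by simp [b']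
  have hcard : Fintype.card ((l : Fin J.numBlocks) × Fin (J.size l)) = Fintype.card (Fin n) := by
    rw [← Module.finrank_eq_card_basis b', Module.finrank_fintype_fun_eq_card]
  let e := Fintype.equivOfCardEq hcard
  let S : Matrix (Fin n) (Fin n) ℂ := (Pi.basisFun ℂ (Fin n)).toMatrix (b'.reindex e)
  have hS : IsUnit S := by
    have := (Pi.basisFun ℂ (Fin n)).invertibleToMatrix (b'.reindex e)
    exact isUnit_of_invertible S
  have hSapp : ∀ i j, S i j = b (φ (e.symm j)) i := fun i j => by
    simp [S, Module.Basis.toMatrix_apply, hb']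
  refine ⟨J, e, S, hS, ?_⟩
  have key : M.map Complex.ofReal * S = S * Matrix.reindex e e J.toMatrix := by
    ext i j
    obtain ⟨⟨l, k⟩, rfl⟩ := e.surjective j
    have h1 : (M.map Complex.ofReal * S) i (e ⟨l, k⟩) =
        (M.map Complex.ofReal).mulVec (b (φ ⟨l, k⟩)) i := by
      simp [Matrix.mul_apply, Matrix.mulVec, dotProduct, hSapp]
    rw [h1, Matrix.mul_apply, ← e.sum_comp, Fintype.sum_sigma, Finset.sum_eq_single l]
    · have := congrFun (hb (c.symm l).1 k) i
      simp only [φ]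
      rw [this, Finset.sum_apply]
      refine Finset.sum_congr rfl fun x _ => ?_
      simp [hSapp, JordanBlocks.toMatrix, Matrix.blockDiagonal'_apply, φ, J, mul_comm]
    · intro l' _ hl'
      refine Finset.sum_eq_zero fun x _ => ?_
      simp [JordanBlocks.toMatrix, Matrix.blockDiagonal'_apply, hl']
    · simp
  rw [mul_assoc, key, ← mul_assoc, Matrix.nonsing_inv_mul _ ((Matrix.isUnit_iff_isUnit_det _).1 hS),
    one_mul]

/-- Letting `X` act by `M` makes `ℂⁿ` a finitely generated torsion `ℂ[X]`-module; each cyclic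
summand of its primary decomposition contributes one block. -/
theorem exists_isNormalFormOf {n : ℕ} (M : Matrix (Fin n) (Fin n) ℝ) :
    ∃ J : JordanBlocks, J.IsNormalFormOf M := by
  classical
  let f : Module.End ℂ (Fin n → ℂ) := Matrix.toLin' (M.map Complex.ofReal)
  obtain ⟨ι, _, p, hp, e, ⟨g⟩⟩ := Module.equiv_directSum_of_isTorsion
    (R := ℂ[X]) (M := Module.AEval' f) (Module.AEval.isTorsion_of_finiteDimensional ℂ _ f)
  choose μ b hb using fun i => exists_basis_quotient_pow_irreducible (hp i) (e i)
  let B : Module.Basis ((i : ι) × Fin (e i)) ℂ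
    (DirectSum ι fun i => ℂ[X] ⧸ Submodule.span ℂ[X] {p i ^ e i}) := DFinsupp.basis b
  let g' := (g.restrictScalars ℂ).symm.trans (Module.AEval'.of f).symm
  refine exists_isNormalForm_of_basis M e μ (B.map g') fun i j => ?_
  have hX : ∀ x, (M.map Complex.ofReal).mulVec (g' x) = g' ((X : ℂ[X]) • x) := by
    intro x
    simp only [g', LinearEquiv.trans_apply, LinearEquiv.restrictScalars_symm_apply]
    rw [map_smul]
    apply (Module.AEval'.of f).injective
    rw [LinearEquiv.apply_symm_apply]
    obtain ⟨y, hy⟩ := (Module.AEval'.of f).surjective (g.symm x)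
    rw [← hy, LinearEquiv.symm_apply_apply, Module.AEval'.X_smul_of]
    rfl
  have hB : ∀ k, B ⟨i, k⟩ = DirectSum.lof ℂ[X] ι _ i (b i k) := fun k => by
    simp only [B, DFinsupp.basis, DirectSum.lof]
    simp
    rfl
  have hB' : ∀ (z : ℂ) k, z • B ⟨i, k⟩ = DirectSum.lof ℂ[X] ι _ i (z • b i k) := fun z k => by
    rw [hB, LinearMap.map_smul_of_tower]
  simp only [Module.Basis.map_apply]
  rw [hX, hB, ← map_smul, hb, map_sum, map_sum]
  refine Finset.sum_congr rfl fun k _ => ?_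
  rw [← hB', map_smul]

/-! ### Multiplicities of Jordan blocks from ranks; the parity obstruction. -/

section Rank

/-- A factorization `V M U = diag(1, …, 1, 0, …, 0)` with `V`, `U` invertible is carried along by
`f`. It is applied to complex conjugation and to `ℝ → ℂ`. -/
theorem rank_map_fieldHom {K F m : Type*} [Field K] [Field F] [Fintype m] [DecidableEq m]
    (f : K →+* F) (M : Matrix m m K) : (M.map f).rank = M.rank := by
  classical
  obtain ⟨V, U, e, hV, hU, h⟩ := M.exists_rank_normal_form
  have hmap : ∀ {W : Matrix m m K}, IsUnit W → IsUnit (W.map f).det := fun {W} hW =>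
    (Matrix.isUnit_iff_isUnit_det _).1 (hW.map f.mapMatrix)
  have h' : V.map f * M.map f * U.map f = (Matrix.diagonal (fun i =>
      Sum.elim (fun _ => (1 : F)) (fun _ => 0) (e i))) := by
    rw [← Matrix.map_mul, ← Matrix.map_mul, h]
    ext i j
    simp only [Matrix.map_apply, Matrix.submatrix_apply, Matrix.diagonal_apply]
    have hij : i = j ↔ e i = e j := e.injective.eq_iff.symm
    simp only [hij]
    rcases e i with a | a <;> rcases e j with b | b <;> simp [Matrix.one_apply, apply_ite f]
  rw [← Matrix.rank_mul_eq_right_of_isUnit_det _ _ (hmap hV),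
    ← Matrix.rank_mul_eq_left_of_isUnit_det _ _ (hmap hU), h', Matrix.rank_diagonal]
  have hcard : Fintype.card {i // Sum.elim (fun _ => (1 : F)) (fun _ => 0) (e i) ≠ 0} =
      Fintype.card (Fin M.rank) := by
    refine (Fintype.card_of_bijective (f := fun a : Fin M.rank =>
      (⟨e.symm (Sum.inl a), by simp⟩ :
        {i // Sum.elim (fun _ => (1 : F)) (fun _ => 0) (e i) ≠ 0})) ⟨?_, ?_⟩).symm
    · intro a b h
      simpa using h
    · rintro ⟨i, hi⟩
      obtain ⟨x, rfl⟩ := e.symm.surjective i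
      rcases x with a | a
      · exact ⟨a, rfl⟩
      · simp at hi
  rw [hcard, Fintype.card_fin]

/-- The kernel of a block diagonal matrix is the product of the kernels of the blocks. -/
def kerBlockDiagonalEquiv {K o : Type*} [Field K] [Fintype o] [DecidableEq o] {m : o → Type*}
    [∀ i, Fintype (m i)] [∀ i, DecidableEq (m i)] (B : ∀ i, Matrix (m i) (m i) K) :
    LinearMap.ker (Matrix.blockDiagonal' B).mulVecLin ≃ₗ[K]
      ((i : o) → LinearMap.ker (B i).mulVecLin) := by
  have key : ∀ v i k, (Matrix.blockDiagonal' B).mulVec v ⟨i, k⟩ =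
      (B i).mulVec (fun j => v ⟨i, j⟩) k := by
    intro v i k
    simp only [Matrix.mulVec, dotProduct]
    rw [Fintype.sum_sigma, Finset.sum_eq_single i]
    · simp [Matrix.blockDiagonal'_apply]
    · intro j _ hj
      exact Finset.sum_eq_zero fun x _ => by simp [Matrix.blockDiagonal'_apply, hj.symm]
    · simp
  exact
    { toFun := fun v i => ⟨fun k => v.1 ⟨i, k⟩, by
        ext k
        have := congrFun v.2 ⟨i, k⟩
        rwa [Matrix.mulVecLin_apply, key] at this⟩
      map_add' := fun _ _ => rfl
      map_smul' := fun _ _ => rfl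
      invFun := fun w => ⟨fun x => (w x.1).1 x.2, by
        ext ⟨i, k⟩
        rw [Matrix.mulVecLin_apply, key]
        exact congrFun (w i).2 k⟩
      left_inv := fun _ => rfl
      right_inv := fun _ => rfl }

theorem finrank_ker_add_rank {K m : Type*} [Field K] [Fintype m] (M : Matrix m m K) :
    M.rank + Module.finrank K (LinearMap.ker M.mulVecLin) = Fintype.card m := by
  rw [Matrix.rank, LinearMap.finrank_range_add_finrank_ker, Module.finrank_fintype_fun_eq_card]

theorem rank_shiftMatrix_pow {K : Type*} [Field K] (m k : ℕ) :
    (shiftMatrix K m ^ k).rank + min k m = m := by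
  have hv : ∀ v i, (shiftMatrix K m ^ k).mulVec v i =
      if h : (i : ℕ) + k < m then v ⟨i + k, h⟩ else 0 := by
    intro v i
    simp only [Matrix.mulVec, dotProduct, shiftMatrix_pow_apply, ite_mul, one_mul, zero_mul]
    split_ifs with h
    · rw [Finset.sum_eq_single (⟨i + k, h⟩ : Fin m)]
      · simp
      · intro b _ hb
        exact if_neg fun h' => hb (Fin.ext h'.symm)
      · simp
    · refine Finset.sum_eq_zero fun b _ => if_neg ?_
      have := b.2
      omega
  -- The `k`-th power shifts coordinates by `k`, so its kernel consists of the vectors supported on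
  -- the first `min k m` coordinates.
  let g : LinearMap.ker (shiftMatrix K m ^ k).mulVecLin ≃ₗ[K] (Fin (min k m) → K) :=
    { toFun := fun v i => v.1 (Fin.castLE (min_le_right _ _) i)
      map_add' := fun _ _ => rfl
      map_smul' := fun _ _ => rfl
      invFun := fun w => ⟨fun j => if h : (j : ℕ) < min k m then w ⟨j, h⟩ else 0, by
        ext i
        rw [Matrix.mulVecLin_apply, hv]
        by_cases h : (i : ℕ) + k < m
        · rw [dif_pos h]
          exact dif_neg (not_lt.2 ((min_le_left k m).trans (Nat.le_add_left k i)))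
        · rw [dif_neg h]
          rfl⟩
      left_inv := fun v => by
        ext j
        simp only
        split_ifs with h
        · rfl
        · have hk : k ≤ j := by have := j.2; omega
          have := congrFun v.2 ⟨j - k, by omega⟩
          rw [Matrix.mulVecLin_apply, hv, dif_pos (by simp only; omega)] at this
          rw [Pi.zero_apply] at this
          exact this.symm.trans (congrArg v.1 (Fin.ext (Nat.sub_add_cancel hk)))
      right_inv := fun w => by
        ext i
        exact dif_pos i.2 }
  have h1 := finrank_ker_add_rank (shiftMatrix K m ^ k)
  rw [g.finrank_eq, Module.finrank_fintype_fun_eq_card, Fintype.card_fin, Fintype.card_fin] at h1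
  exact h1

theorem isUnit_jordanBlock (m : ℕ) {μ : ℂ} (hμ : μ ≠ 0) : IsUnit (jordanBlock m μ) := by
  obtain ⟨L, hL⟩ := exists_exp_eq_jordanBlock m hμ
  rw [← hL]
  exact Matrix.isUnit_exp L

theorem jordanBlock_sub (m : ℕ) (μ z : ℂ) : jordanBlock m μ - z • 1 = jordanBlock m (μ - z) := by
  rw [jordanBlock_eq, jordanBlock_eq, sub_smul]
  abel

theorem finrank_ker_jordanBlock_pow (m k : ℕ) (μ : ℂ) :
    Module.finrank ℂ (LinearMap.ker (jordanBlock m μ ^ k).mulVecLin) =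
      if μ = 0 then min k m else 0 := by
  have h := finrank_ker_add_rank (jordanBlock m μ ^ k)
  rw [Fintype.card_fin] at h
  split_ifs with hμ
  · have h1 := rank_shiftMatrix_pow (K := ℂ) m k
    rw [hμ, jordanBlock_eq, zero_smul, zero_add] at h ⊢
    omega
  · rw [Matrix.rank_of_isUnit _ ((isUnit_jordanBlock m hμ).pow k), Fintype.card_fin] at h
    omega

/-- The dimension of the kernel of `(J - μ) ^ k`. -/
noncomputable def JordanBlocks.nullity (J : JordanBlocks) (k : ℕ) (μ : ℂ) : ℕ :=
  ∑ l, if J.eigenvalue l = μ then min k (J.size l) else 0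

theorem JordanBlocks.toMatrix_sub_pow (J : JordanBlocks) (k : ℕ) (μ : ℂ) :
    (J.toMatrix - μ • 1) ^ k =
      Matrix.blockDiagonal' fun l => jordanBlock (J.size l) (J.eigenvalue l - μ) ^ k := by
  have h1 : (μ • 1 : Matrix ((l : Fin J.numBlocks) × Fin (J.size l)) _ ℂ) =
      Matrix.blockDiagonal' fun l => (μ • 1 : Matrix (Fin (J.size l)) (Fin (J.size l)) ℂ) := by
    rw [← Matrix.blockDiagonal'_one, ← Matrix.blockDiagonal'_smul]
    rfl
  rw [h1, JordanBlocks.toMatrix, ← Matrix.blockDiagonal'_sub, ← Matrix.blockDiagonal'_pow]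
  congr 1
  ext l : 1
  simp only [Pi.pow_apply, Pi.sub_apply, jordanBlock_sub]

theorem JordanBlocks.rank_add_nullity (J : JordanBlocks) (k : ℕ) (μ : ℂ) :
    ((J.toMatrix - μ • 1) ^ k).rank + J.nullity k μ =
      Fintype.card ((l : Fin J.numBlocks) × Fin (J.size l)) := by
  rw [← finrank_ker_add_rank ((J.toMatrix - μ • 1) ^ k), J.toMatrix_sub_pow,
    (kerBlockDiagonalEquiv _).finrank_eq, Module.finrank_pi_fintype]
  simp only [finrank_ker_jordanBlock_pow, sub_eq_zero, JordanBlocks.nullity]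

/-- This expresses the nullities of `J` through ranks computed from `M` alone, so that symmetries of
`M` become symmetries of its blocks. -/
theorem JordanBlocks.IsNormalFormOf.rank_add_nullity {J : JordanBlocks} {n : ℕ}
    {M : Matrix (Fin n) (Fin n) ℝ} (h : J.IsNormalFormOf M) (k : ℕ) (μ : ℂ) :
    ((M.map Complex.ofReal - μ • 1) ^ k).rank + J.nullity k μ = n := by
  obtain ⟨e, S, hS, h⟩ := h
  have hdet := (Matrix.isUnit_iff_isUnit_det _).1 hS
  have h1 : S⁻¹ * (M.map Complex.ofReal - μ • 1) ^ k * S =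
      Matrix.reindex e e ((J.toMatrix - μ • 1) ^ k) := by
    obtain ⟨u, rfl⟩ := hS
    rw [← Matrix.coe_units_inv] at h ⊢
    rw [← Units.conj_pow' u, mul_sub, sub_mul, h, mul_smul_comm, mul_one, smul_mul_assoc,
      Units.inv_mul, ← Matrix.coe_reindexAlgEquiv ℂ ℂ e, map_pow, map_sub, map_smul, map_one]
  have hdet' : IsUnit (S⁻¹).det := by
    rw [Matrix.det_nonsing_inv]; exact hdet.ringInverse
  rw [← Matrix.rank_mul_eq_right_of_isUnit_det _ _ hdet',
    ← Matrix.rank_mul_eq_left_of_isUnit_det _ _ hdet, h1, Matrix.rank_reindex,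
    J.rank_add_nullity, Fintype.card_congr e, Fintype.card_fin]

/-- The second difference of `k ↦ min k s` at `m` is `-1` if `s = m` and `0` otherwise. -/
theorem JordanBlocks.multiplicity_add (J : JordanBlocks) {m : ℕ} (hm : 0 < m) (μ : ℂ) :
    J.multiplicity m μ + J.nullity (m - 1) μ + J.nullity (m + 1) μ = 2 * J.nullity m μ := by
  rw [JordanBlocks.multiplicity, Finset.card_filter, JordanBlocks.nullity, JordanBlocks.nullity,
    JordanBlocks.nullity, ← Finset.sum_add_distrib, ← Finset.sum_add_distrib, Finset.mul_sum]
  refine Finset.sum_congr rfl fun l _ => ?_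
  by_cases h : J.eigenvalue l = μ <;> by_cases h' : J.size l = m <;> simp [h, h'] <;> omega

theorem JordanBlocks.multiplicity_zero (J : JordanBlocks) (μ : ℂ) : J.multiplicity 0 μ = 0 := by
  rw [JordanBlocks.multiplicity, Finset.card_eq_zero, Finset.filter_eq_empty_iff]
  rintro l - ⟨h, -⟩
  exact (J.size_pos l).ne' h

variable {J : JordanBlocks} {n : ℕ} {M : Matrix (Fin n) (Fin n) ℝ}

/-- As `M` is real, entrywise conjugation turns `(M - μ) ^ k` into `(M - conj μ) ^ k` and preserves
rank. -/
theorem JordanBlocks.IsNormalFormOf.nullity_conj (h : J.IsNormalFormOf M) (k : ℕ) (μ : ℂ) :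
    J.nullity k (starRingEnd ℂ μ) = J.nullity k μ := by
  have h1 := h.rank_add_nullity k μ
  have h2 := h.rank_add_nullity k (starRingEnd ℂ μ)
  have h3 : (M.map Complex.ofReal - starRingEnd ℂ μ • 1) ^ k =
      ((M.map Complex.ofReal - μ • 1) ^ k).map (starRingEnd ℂ) := by
    change _ = (starRingEnd ℂ).mapMatrix _
    rw [map_pow, map_sub]
    congr 2
    · ext i j; simp
    · ext i j; simp [Matrix.one_apply, apply_ite (starRingEnd ℂ)]
  rw [h3, rank_map_fieldHom] at h2
  omega

theorem JordanBlocks.IsNormalFormOf.multiplicity_conj (h : J.IsNormalFormOf M) (m : ℕ) (μ : ℂ) :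
    J.multiplicity m (starRingEnd ℂ μ) = J.multiplicity m μ := by
  rcases Nat.eq_zero_or_pos m with rfl | hm
  · rw [J.multiplicity_zero, J.multiplicity_zero]
  · have h1 := J.multiplicity_add hm μ
    have h2 := J.multiplicity_add hm (starRingEnd ℂ μ)
    simp only [h.nullity_conj] at h2
    omega

theorem JordanBlocks.IsNormalFormOf.eigenvalue_ne_zero (h : J.IsNormalFormOf M) (hM : IsUnit M)
    (l : Fin J.numBlocks) : J.eigenvalue l ≠ 0 := by
  intro hl
  have h1 := h.rank_add_nullity 1 0
  have h0 : IsUnit (M.map Complex.ofReal) := hM.map Complex.ofRealHom.mapMatrix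
  rw [zero_smul, sub_zero, pow_one, Matrix.rank_of_isUnit _ h0, Fintype.card_fin] at h1
  have h2 : J.nullity 1 0 = 0 := by omega
  rw [JordanBlocks.nullity, Finset.sum_eq_zero_iff] at h2
  have := h2 l (Finset.mem_univ _)
  rw [if_pos hl] at this
  have := J.size_pos l
  omega

/-- If `N ^ 2 = M` then the generalized eigenspaces of `M` for a negative eigenvalue are even
dimensional. -/
theorem even_finrank_ker_of_mul_self {N : Matrix (Fin n) (Fin n) ℝ} {r : ℝ} (hr : r < 0) (k : ℕ) :
    Even (Module.finrank ℝ (LinearMap.ker ((N * N - r • 1) ^ k).mulVecLin)) := by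
  set f : Module.End ℝ (Fin n → ℝ) := N.mulVecLin with hf
  have hlin : ((N * N - r • 1) ^ k).mulVecLin = (f * f - r • 1) ^ k := by
    have : ∀ X : Matrix (Fin n) (Fin n) ℝ, X.mulVecLin = Matrix.toLinAlgEquiv' X := fun X => rfl
    rw [hf, this, this, map_pow, map_sub, map_mul, map_smul, map_one]
  rw [hlin]
  set W := LinearMap.ker ((f * f - r • 1) ^ k) with hW
  have hcomm : Commute f ((f * f - r • 1) ^ k) :=
    (((Commute.refl f).mul_right (Commute.refl f)).sub_right
      ((Commute.one_right f).smul_right r)).pow_right k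
  have hfW : ∀ x ∈ W, f x ∈ W := fun x hx => by
    rw [hW, LinearMap.mem_ker] at hx ⊢
    rw [← Module.End.mul_apply, ← hcomm.eq, Module.End.mul_apply, hx, map_zero]
  set g : Module.End ℝ W := f.restrict hfW with hg
  set ν : Module.End ℝ W := r • 1 - g * g with hν
  have hνpow : ∀ (j : ℕ) (x : W), (((-ν) ^ j) x : Fin n → ℝ) = ((f * f - r • 1) ^ j) (x : _) := by
    intro j
    induction j with
    | zero => intro x; rfl
    | succ j ih =>
      intro x
      rw [pow_succ, pow_succ, Module.End.mul_apply, Module.End.mul_apply, ih]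
      simp [hν, hg]
  have hnil : IsNilpotent ν := by
    suffices h : IsNilpotent (-ν) from neg_neg ν ▸ h.neg
    refine ⟨k, LinearMap.ext fun x => Subtype.ext ?_⟩
    rw [hνpow]
    exact x.2
  -- The characteristic polynomial of the nilpotent `ν` is `X ^ dim W`; its value at `r` is `det (r
  -- - ν) = (det g) ^ 2`, a square, whereas an odd power of `r` would be negative.
  have hdet := LinearMap.eval_charpoly ν r
  rw [hnil.charpoly_eq_X_pow_finrank, eval_pow, eval_X, Algebra.algebraMap_eq_smul_one,
    hν, show r • 1 - (r • 1 - g * g) = g * g by abel, map_mul] at hdet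
  by_contra hodd
  have := (Nat.not_even_iff_odd.1 hodd).pow_neg hr
  nlinarith [mul_self_nonneg (LinearMap.det g)]

/-- For real `r` the complex nullities equal the real kernel dimensions, all even, and the
multiplicity is an integer combination of them. -/
theorem JordanBlocks.IsNormalFormOf.even_multiplicity_of_mul_self
    {N : Matrix (Fin n) (Fin n) ℝ} (h : J.IsNormalFormOf (N * N)) {r : ℝ} (hr : r < 0) (m : ℕ) :
    Even (J.multiplicity m r) := by
  have hnull : ∀ k, Even (J.nullity k r) := by
    intro k
    have h1 := h.rank_add_nullity k r
    have h2 := finrank_ker_add_rank ((N * N - r • 1) ^ k)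
    have h3 : ((N * N).map Complex.ofReal - (r : ℂ) • 1) ^ k =
        ((N * N - r • 1) ^ k).map Complex.ofRealHom := by
      change _ = Complex.ofRealHom.mapMatrix _
      rw [map_pow, map_sub]
      congr 2
      ext i j; simp [Matrix.one_apply, apply_ite Complex.ofReal]
    rw [h3, rank_map_fieldHom] at h1
    rw [Fintype.card_fin] at h2
    have h4 := even_finrank_ker_of_mul_self (N := N) hr k
    have h5 : J.nullity k r =
        Module.finrank ℝ (LinearMap.ker ((N * N - r • 1) ^ k).mulVecLin) := by omega
    rwa [h5]
  rcases Nat.eq_zero_or_pos m with rfl | hm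
  · rw [J.multiplicity_zero]; exact Even.zero
  · have h1 := J.multiplicity_add hm (r : ℂ)
    have h2 := hnull (m - 1)
    have h3 := hnull (m + 1)
    rw [Nat.even_iff] at *
    omega

end Rank

/-! ### Pairing the blocks. -/

section Involution

/-- If the fibres of `f` over `b` and `c b` are equinumerous, and those over the bad fixed points
of the involution `c` are even, then `c` lifts to an involution whose fixed points are good. -/
theorem exists_involution_lift {α β : Type*} [Fintype α] [DecidableEq β] (f : α → β) {c : β → β}
    (hc : Function.Involutive c) (good : β → Prop)
    (hcard : ∀ b, Fintype.card {a // f a = c b} = Fintype.card {a // f a = b})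
    (heven : ∀ b, c b = b → ¬ good b → Even (Fintype.card {a // f a = b})) :
    ∃ σ : α → α, Function.Involutive σ ∧ (∀ a, f (σ a) = c (f a)) ∧
      ∀ a, σ a = a → good (f a) := by
  classical
  let E : ∀ b, {a // f a = b} ≃ Fin (Fintype.card {a // f a = b}) := fun b => Fintype.equivFin _
  let r : α → ℕ := fun a => E (f a) ⟨a, rfl⟩
  have hr : ∀ b x (h : f x = b), r x = E b ⟨x, h⟩ := by
    rintro b x rfl
    rfl
  have huniq : ∀ x y, f x = f y → r x = r y → x = y := by
    intro x y hxy h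
    rw [hr (f y) x hxy, hr (f y) y rfl] at h
    exact congrArg Subtype.val ((E (f y)).injective (Fin.ext h))
  -- Each fibre is enumerated. Over a bad fixed point the positions `2j` and `2j + 1` are swapped,
  -- which evenness permits; elsewhere an element goes to the one with the same position in the
  -- fibre over `c b`.
  let τ : β → ℕ → ℕ := fun b i =>
    if c b = b ∧ ¬ good b then (if i % 2 = 0 then i + 1 else i - 1) else i
  have hττ : ∀ b i, τ b (τ b i) = i := by
    intro b i
    simp only [τ]
    split_ifs <;> omega
  have hτc : ∀ b i, τ (c b) i = τ b i := by
    intro b i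
    by_cases h : c b = b
    · rw [h]
    · have h' : ¬ c (c b) = c b := fun h' => h (hc.injective h')
      simp only [τ, h, h', false_and, if_false]
  have hτlt : ∀ a, τ (f a) (r a) < Fintype.card {x // f x = c (f a)} := by
    intro a
    rw [hcard]
    have hlt : r a < Fintype.card {x // f x = f a} := (E (f a) ⟨a, rfl⟩).2
    simp only [τ]
    split_ifs with h h2
    · have := heven _ h.1 h.2
      rw [Nat.even_iff] at this
      omega
    · omega
    · exact hlt
  let σ : α → α := fun a => ((E (c (f a))).symm ⟨τ (f a) (r a), hτlt a⟩).1
  have hσf : ∀ a, f (σ a) = c (f a) := fun a =>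
    ((E (c (f a))).symm ⟨τ (f a) (r a), hτlt a⟩).2
  have hσr : ∀ a, r (σ a) = τ (f a) (r a) := by
    intro a
    rw [hr _ _ (hσf a)]
    simp [σ]
  refine ⟨σ, fun a => huniq _ _ ?_ ?_, hσf, fun a ha => ?_⟩
  · rw [hσf, hσf, hc]
  · rw [hσr, hσr, hσf, hτc, hττ]
  · by_contra hg
    have h1 : c (f a) = f a := by rw [← hσf, ha]
    have h2 := hσr a
    rw [ha] at h2
    simp only [τ, h1, hg, not_false_eq_true, and_self, if_true] at h2
    split_ifs at h2 <;> omega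

end Involution

/-! ### Descent from complex to real similarity. -/

section Similarity

/-- Two real matrices that are similar over `ℂ` are similar over `ℝ`. -/
theorem exists_real_similarity {m : Type*} [Fintype m] [DecidableEq m] {A B : Matrix m m ℝ}
    {S : Matrix m m ℂ} (hS : IsUnit S)
    (h : A.map Complex.ofReal * S = S * B.map Complex.ofReal) :
    ∃ V : Matrix m m ℝ, IsUnit V ∧ A * V = V * B := by
  let S₁ : Matrix m m ℝ := S.map Complex.re
  let S₂ : Matrix m m ℝ := S.map Complex.im
  have h1 : A * S₁ = S₁ * B := by
    ext i j
    have := congrArg Complex.re (congrFun (congrFun h i) j)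
    simpa [Matrix.mul_apply, S₁] using this
  have h2 : A * S₂ = S₂ * B := by
    ext i j
    have := congrArg Complex.im (congrFun (congrFun h i) j)
    simpa [Matrix.mul_apply, S₂] using this
  -- Every `S₁ + t • S₂` intertwines `A` and `B`. Its determinant is a polynomial in `t` that equals
  -- `det S ≠ 0` at `t = i`, so it is nonzero at some real `t`.
  let p : Polynomial ℝ := (S₁.map Polynomial.C + (Polynomial.X : Polynomial ℝ) •
    S₂.map Polynomial.C).det
  have hp : p ≠ 0 := by
    intro hp
    have h3 : Polynomial.eval₂RingHom Complex.ofRealHom Complex.I p = S.det := by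
      simp only [p]
      rw [RingHom.map_det]
      congr 1
      ext i j
      simp only [RingHom.mapMatrix_apply, Matrix.map_apply, Matrix.add_apply, Matrix.smul_apply,
        smul_eq_mul, map_add, map_mul]
      simp only [Polynomial.coe_eval₂RingHom, Polynomial.eval₂_C, Polynomial.eval₂_X, S₁, S₂,
        Matrix.map_apply]
      rw [mul_comm]
      exact Complex.re_add_im _
    rw [hp, map_zero] at h3
    exact ((Matrix.isUnit_iff_isUnit_det _).1 hS).ne_zero h3.symm
  obtain ⟨t, ht⟩ : ∃ t : ℝ, p.eval t ≠ 0 := by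
    by_contra hcon
    push Not at hcon
    exact hp (Polynomial.funext fun t => by rw [hcon, Polynomial.eval_zero])
  have h4 : p.eval t = (S₁ + t • S₂).det := by
    rw [← Polynomial.coe_evalRingHom]
    simp only [p]
    rw [RingHom.map_det]
    congr 1
    ext i j
    simp
    exact mul_comm _ _
  refine ⟨S₁ + t • S₂, (Matrix.isUnit_iff_isUnit_det _).2 (isUnit_iff_ne_zero.2 (h4 ▸ ht)), ?_⟩
  rw [mul_add, add_mul, h1, mul_smul_comm, smul_mul_assoc, h2]

/-- A complex matrix that is turned into its conjugate by an involutive permutation of the indices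
is similar to a real matrix. -/
theorem exists_similar_real_of_conj_eq_submatrix {m : Type*} [Fintype m] [DecidableEq m]
    (L : Matrix m m ℂ) {π : m → m} (hπ : Function.Involutive π)
    (h : ∀ x y, L (π x) (π y) = starRingEnd ℂ (L x y)) :
    ∃ (B : Matrix m m ℝ) (U : Matrix m m ℂ), IsUnit U ∧ U * B.map Complex.ofReal = L * U := by
  let P : Matrix m m ℝ := Matrix.of fun i j => if π i = j then 1 else 0
  let R : Matrix m m ℝ := L.map Complex.re
  let I : Matrix m m ℝ := L.map Complex.im
  have hPmul : ∀ X : Matrix m m ℝ, P * X = X.submatrix π id := by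
    intro X
    ext i j
    simp [P, Matrix.mul_apply]
  have hmulP : ∀ X : Matrix m m ℝ, X * P = X.submatrix id π := by
    intro X
    ext i j
    simp only [P, Matrix.mul_apply, Matrix.of_apply, mul_ite, mul_one, mul_zero,
      Matrix.submatrix_apply, id]
    rw [Finset.sum_eq_single (π j)]
    · rw [if_pos (hπ j)]
    · intro b _ hb
      exact if_neg fun h' => hb (by rw [← h', hπ])
    · simp
  have hPP : P * P = 1 := by
    rw [hPmul]
    ext i j
    simp [P, Matrix.one_apply, hπ i]
  have hPR : P * R = R * P := by
    rw [hPmul, hmulP]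
    ext i j
    have := congrArg Complex.re (h i (π j))
    rw [hπ] at this
    simpa [R] using this
  have hPI : P * I = -(I * P) := by
    rw [hPmul, hmulP]
    ext i j
    have := congrArg Complex.im (h i (π j))
    rw [hπ] at this
    simpa [I] using this
  let φ := Complex.ofRealHom.mapMatrix (m := m)
  have hL : L = φ R + Complex.I • φ I := by
    ext i j
    simp only [φ, R, I, RingHom.mapMatrix_apply, Matrix.map_apply, Matrix.add_apply,
      Matrix.smul_apply, smul_eq_mul]
    rw [mul_comm]
    exact (Complex.re_add_im _).symm
  have hPP' : φ P * φ P = 1 := by rw [← map_mul, hPP, map_one]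
  -- With `L = R + iI`, the symmetry says that `P` commutes with `R` and anticommutes with `I`.
  -- Since `P² = 1`, `1 + iP` has inverse `(1 - iP) / 2`, and expanding both products gives `(1 +
  -- iP)(R - IP) = (R + iI)(1 + iP)`.
  refine ⟨R - I * P, 1 + Complex.I • φ P, ?_, ?_⟩
  · refine IsUnit.of_mul_eq_one ((2⁻¹ : ℂ) • (1 - Complex.I • φ P)) ?_
    rw [mul_smul_comm, add_mul, mul_sub, mul_sub, one_mul, one_mul, mul_one, smul_mul_smul_comm,
      hPP', Complex.I_mul_I]
    ext i j
    simp only [Matrix.smul_apply, Matrix.add_apply, Matrix.sub_apply, smul_eq_mul]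
    ring
  · change (1 + Complex.I • φ P) * φ (R - I * P) = L * (1 + Complex.I • φ P)
    have h1 : φ P * φ R = φ R * φ P := by rw [← map_mul, ← map_mul, hPR]
    have h2 : φ P * (φ I * φ P) = - φ I := by
      rw [← mul_assoc, ← map_mul, hPI, map_neg, map_mul, neg_mul, mul_assoc, hPP', mul_one]
    rw [hL, map_sub, map_mul, add_mul, one_mul, smul_mul_assoc, mul_sub, h1, h2, mul_add, mul_one,
      mul_smul_comm, add_mul, smul_mul_assoc, smul_add, smul_smul, Complex.I_mul_I, smul_sub,
      smul_neg, neg_smul, one_smul]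
    abel

end Similarity

/-! ### Real logarithms of real matrices. -/

section RealLog

variable {J : JordanBlocks} {n : ℕ} {M : Matrix (Fin n) (Fin n) ℝ}

theorem JordanBlocks.multiplicity_eq_card (J : JordanBlocks) (m : ℕ) (μ : ℂ) :
    J.multiplicity m μ = Fintype.card {l // (J.size l, J.eigenvalue l) = (m, μ)} := by
  rw [JordanBlocks.multiplicity, Fintype.card_subtype]
  simp only [Prod.mk.injEq]

open Classical in
theorem JordanBlocks.oddNegativeDim_eq_zero_iff (J : JordanBlocks) :
    J.oddNegativeDim = 0 ↔ ∀ (m : ℕ) (r : ℝ), r < 0 → Even (J.multiplicity m r) := by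
  rw [JordanBlocks.oddNegativeDim, Finset.sum_eq_zero_iff]
  constructor
  · intro h m r hr
    by_contra hodd
    rw [Nat.not_even_iff_odd] at hodd
    obtain ⟨l, hl⟩ := Finset.card_pos.1 hodd.pos
    obtain ⟨-, rfl, hμ⟩ := Finset.mem_filter.1 hl
    refine (J.size_pos l).ne' (h (J.size l, (r : ℂ)) (Finset.mem_filter.2 ⟨?_, ⟨r, hr, rfl⟩, hodd⟩))
    exact Finset.mem_image.2 ⟨l, Finset.mem_univ _, by rw [hμ]⟩
  · rintro h ⟨m, μ⟩ hp
    obtain ⟨-, ⟨r, hr, hμ⟩, hodd⟩ := Finset.mem_filter.1 hp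
    simp only at hμ hodd
    rw [hμ] at hodd
    exact absurd (h m r hr) (Nat.not_even_iff_odd.2 hodd)

/-- Logarithms of the blocks, compatible with the pairing of conjugate blocks. -/
theorem exists_blockwise_log {J : JordanBlocks} {σ : Fin J.numBlocks → Fin J.numBlocks}
    (hσ : Function.Involutive σ) (hsize : ∀ l, J.size (σ l) = J.size l)
    (heig : ∀ l, J.eigenvalue (σ l) = starRingEnd ℂ (J.eigenvalue l))
    (hne : ∀ l, J.eigenvalue l ≠ 0) (hfix : ∀ l, σ l = l → 0 < (J.eigenvalue l).re) :
    ∃ L : ∀ l, Matrix (Fin (J.size l)) (Fin (J.size l)) ℂ,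
      (∀ l, NormedSpace.exp (L l) = jordanBlock (J.size l) (J.eigenvalue l)) ∧
      ∀ l i j, L (σ l) (Fin.cast (hsize l).symm i) (Fin.cast (hsize l).symm j) =
        starRingEnd ℂ (L l i j) := by
  -- The logarithms are chosen by size and eigenvalue, not by block, so that the two members of a
  -- pair refer to the same matrix.
  choose F hF using fun (m : ℕ) (μ : {μ : ℂ // μ ≠ 0}) => exists_exp_eq_jordanBlock m μ.2
  choose G hG using fun (m : ℕ) (r : {r : ℝ // 0 < r}) => exists_real_exp_eq_jordanBlock m r.2
  have hFcast : ∀ {m m' : ℕ} (h : m = m') {μ μ'} (_ : μ' = μ) (i j),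
      F m' μ' (Fin.cast h i) (Fin.cast h j) = F m μ i j := by
    rintro m _ rfl μ _ rfl i j; rfl
  have hGcast : ∀ {m m' : ℕ} (h : m = m') {r r'} (_ : r' = r) (i j),
      G m' r' (Fin.cast h i) (Fin.cast h j) = G m r i j := by
    rintro m _ rfl r _ rfl i j; rfl
  have hne' : ∀ l, starRingEnd ℂ (J.eigenvalue l) ≠ 0 := fun l => by
    rw [← heig]; exact hne _
  have hblock : ∀ m μ, (jordanBlock m (starRingEnd ℂ μ)).map (starRingEnd ℂ) =
      jordanBlock m μ := by
    intro m μ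
    ext i j
    simp only [jordanBlock, Matrix.map_apply, Matrix.of_apply]
    split_ifs <;> simp
  -- A fixed block has a positive real eigenvalue and gets a real logarithm. In a pair, the smaller
  -- index gets the chosen logarithm and the larger one its conjugate; this also serves two equal
  -- blocks with a negative eigenvalue.
  let L : ∀ l, Matrix (Fin (J.size l)) (Fin (J.size l)) ℂ := fun l =>
    if h : σ l = l then (G (J.size l) ⟨(J.eigenvalue l).re, hfix l h⟩).map Complex.ofReal
    else if l < σ l then F (J.size l) ⟨J.eigenvalue l, hne l⟩
    else (F (J.size l) ⟨starRingEnd ℂ (J.eigenvalue l), hne' l⟩).map (starRingEnd ℂ)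
  refine ⟨L, fun l => ?_, fun l i j => ?_⟩
  · simp only [L]
    split_ifs with h h'
    · rw [hG]
      congr 1
      rw [← Complex.conj_eq_iff_re, ← heig, h]
    · rw [hF]
    · rw [exp_map_conj, hF, hblock]
  · simp only [L]
    by_cases h : σ l = l
    · have hh : σ (σ l) = σ l := congrArg σ h
      rw [dif_pos hh, dif_pos h, Matrix.map_apply, Matrix.map_apply, Complex.conj_ofReal]
      refine congrArg Complex.ofReal (hGcast (hsize l).symm (Subtype.ext ?_) i j)
      simp only [h]
    · have hh : ¬ σ (σ l) = σ l := fun hh => h (hσ.injective hh)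
      rw [dif_neg hh, dif_neg h, hσ l]
      rcases lt_or_gt_of_ne h with h' | h'
      · rw [if_pos h', if_neg h'.not_gt, Matrix.map_apply, Complex.conj_conj]
        exact hFcast (hsize l).symm (Subtype.ext (heig l)) i j
      · rw [if_neg h'.not_gt, if_pos h', Matrix.map_apply]
        refine congrArg (starRingEnd ℂ) (hFcast (hsize l).symm (Subtype.ext ?_) i j)
        simp only [heig, Complex.conj_conj]

theorem exp_reindex {m k : Type*} [Fintype m] [DecidableEq m] [Fintype k] [DecidableEq k]
    (e : m ≃ k) (L : Matrix m m ℂ) :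
    NormedSpace.exp (Matrix.reindex e e L) = Matrix.reindex e e (NormedSpace.exp L) := by
  have hc : Continuous (Matrix.reindexAlgEquiv ℂ ℂ e) := by
    change Continuous fun M : Matrix m m ℂ => M.submatrix e.symm e.symm
    exact continuous_id.matrix_submatrix _ _
  open scoped Matrix.Norms.Operator in
  exact (NormedSpace.map_exp (Matrix.reindexAlgEquiv ℂ ℂ e) hc L).symm

/-- A real invertible matrix has a real logarithm if all Jordan blocks with a negative eigenvalue
appear an even number of times. -/
theorem JordanBlocks.IsNormalFormOf.exists_real_log (hJ : J.IsNormalFormOf M) (hM : IsUnit M)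
    (hodd : J.oddNegativeDim = 0) :
    ∃ B : Matrix (Fin n) (Fin n) ℝ, NormedSpace.exp B = M := by
  classical
  rw [J.oddNegativeDim_eq_zero_iff] at hodd
  have hne := hJ.eigenvalue_ne_zero hM
  -- The bad fixed points of conjugation are the real eigenvalues `≤ 0`: negative ones have even
  -- multiplicity by hypothesis, and `0` does not occur because `M` is invertible.
  obtain ⟨σ, hσ, hσf, hfix⟩ := exists_involution_lift
    (fun l => (J.size l, J.eigenvalue l)) (c := fun p => (p.1, starRingEnd ℂ p.2))
    (fun p => by simp) (fun p => 0 < p.2.re)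
    (fun p => by
      rw [← J.multiplicity_eq_card, hJ.multiplicity_conj, J.multiplicity_eq_card])
    (fun p hp hgood => by
      rcases p with ⟨m, μ⟩
      simp only [Prod.mk.injEq, true_and, not_lt] at hp hgood
      rw [← J.multiplicity_eq_card]
      obtain ⟨r, rfl⟩ := Complex.conj_eq_iff_real.1 hp
      rcases hgood.lt_or_eq with h | h
      · exact hodd m r h
      · rw [Complex.ofReal_re] at h
        subst h
        rw [JordanBlocks.multiplicity, Finset.filter_false_of_mem]
        · simp
        · rintro l - ⟨-, hl⟩
          exact hne l (by simpa using hl))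
  simp only [Prod.mk.injEq] at hσf
  obtain ⟨L, hL, hLσ⟩ := exists_blockwise_log hσ (fun l => (hσf l).1) (fun l => (hσf l).2) hne hfix
  let π : ((l : Fin J.numBlocks) × Fin (J.size l)) → (l : Fin J.numBlocks) × Fin (J.size l) :=
    fun x => ⟨σ x.1, Fin.cast (hσf x.1).1.symm x.2⟩
  have hπ : Function.Involutive π := by
    rintro ⟨l, i⟩
    simp only [π]
    refine Sigma.ext (hσ l) ?_
    rw [Fin.heq_ext_iff (congrArg J.size (hσ l))]
    rfl
  obtain ⟨B, U, hU, hBU⟩ := exists_similar_real_of_conj_eq_submatrix (Matrix.blockDiagonal' L) hπ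
    (by
      rintro ⟨l, i⟩ ⟨l', j⟩
      by_cases h : l = l'
      · subst h
        simp only [π, Matrix.blockDiagonal'_apply_eq]
        exact hLσ l i j
      · rw [Matrix.blockDiagonal'_apply_ne _ _ _ h, map_zero]
        exact Matrix.blockDiagonal'_apply_ne _ _ _ fun h' => h (hσ.injective h'))
  have hexpL : NormedSpace.exp (Matrix.blockDiagonal' L) = J.toMatrix := by
    rw [Matrix.exp_blockDiagonal', JordanBlocks.toMatrix]
    congr 1
    ext l : 1
    rw [← hL]
    open scoped Matrix.Norms.Operator in exact Pi.coe_exp L l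
  have hexpB : U * (NormedSpace.exp B).map Complex.ofReal = J.toMatrix * U := by
    have hUdet := (Matrix.isUnit_iff_isUnit_det _).1 hU
    have h1 : B.map Complex.ofReal = U⁻¹ * Matrix.blockDiagonal' L * U := by
      rw [mul_assoc, ← hBU, ← mul_assoc, Matrix.nonsing_inv_mul _ hUdet, one_mul]
    rw [← exp_map_ofReal, h1, Matrix.exp_conj' _ _ hU, hexpL, mul_assoc, ← mul_assoc,
      Matrix.mul_nonsing_inv _ hUdet, one_mul]
  obtain ⟨e, S, hS, hSM⟩ := hJ
  have hSdet := (Matrix.isUnit_iff_isUnit_det _).1 hS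
  have hexpB' : Matrix.reindex e e U * (NormedSpace.exp (Matrix.reindex e e B)).map Complex.ofReal =
      Matrix.reindex e e J.toMatrix * Matrix.reindex e e U := by
    have h1 : (NormedSpace.exp (Matrix.reindex e e B)).map Complex.ofReal =
        Matrix.reindex e e ((NormedSpace.exp B).map Complex.ofReal) := by
      rw [← exp_map_ofReal, ← exp_map_ofReal, ← exp_reindex]
      rfl
    rw [h1]
    simp only [← Matrix.coe_reindexAlgEquiv ℂ ℂ e]
    rw [← map_mul, ← map_mul, hexpB]
  -- Both `M` and the exponential of the reindexed `B` are real and similar over `ℂ` to the Jordan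
  -- matrix.
  obtain ⟨V, hV, hMV⟩ := exists_real_similarity (A := M)
    (B := NormedSpace.exp (Matrix.reindex e e B)) (S := S * Matrix.reindex e e U)
    (hS.mul (hU.map (Matrix.reindexAlgEquiv ℂ ℂ e)))
    (by
      rw [mul_assoc, hexpB', ← hSM]
      simp only [← mul_assoc]
      rw [Matrix.mul_nonsing_inv _ hSdet, one_mul])
  have hVdet := (Matrix.isUnit_iff_isUnit_det _).1 hV
  refine ⟨V * Matrix.reindex e e B * V⁻¹, ?_⟩
  rw [Matrix.exp_conj _ _ hV, ← hMV, mul_assoc, Matrix.mul_nonsing_inv _ hVdet, mul_one]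

theorem JordanBlocks.IsNormalFormOf.similar (hJ : J.IsNormalFormOf M)
    {C : Matrix (Fin n) (Fin n) ℝ} (hC : IsUnit C) : J.IsNormalFormOf (C⁻¹ * M * C) := by
  obtain ⟨e, S, hS, h⟩ := hJ
  have hC' : IsUnit (C.map Complex.ofReal) := hC.map Complex.ofRealHom.mapMatrix
  have hCC : C.map Complex.ofReal * C⁻¹.map Complex.ofReal = 1 := by
    have := congrArg (Complex.ofRealHom.mapMatrix)
      (Matrix.mul_nonsing_inv _ ((Matrix.isUnit_iff_isUnit_det _).1 hC))
    rwa [map_mul, map_one] at this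
  have hinv : (C.map Complex.ofReal)⁻¹ = C⁻¹.map Complex.ofReal :=
    Matrix.inv_eq_right_inv hCC
  have hmap : (C⁻¹ * M * C).map Complex.ofReal =
      C⁻¹.map Complex.ofReal * M.map Complex.ofReal * C.map Complex.ofReal := by
    change Complex.ofRealHom.mapMatrix _ = _
    rw [map_mul, map_mul]
    rfl
  refine ⟨e, (C.map Complex.ofReal)⁻¹ * S, ?_, ?_⟩
  · exact (Matrix.isUnit_nonsing_inv_iff.2 hC').mul hS
  · rw [← h, hmap, Matrix.mul_inv_rev, Matrix.nonsing_inv_nonsing_inv _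
      ((Matrix.isUnit_iff_isUnit_det _).1 hC'), hinv]
    calc _ = S⁻¹ * (C.map Complex.ofReal * C⁻¹.map Complex.ofReal) * M.map Complex.ofReal *
          (C.map Complex.ofReal * C⁻¹.map Complex.ofReal) * S := by simp only [mul_assoc]
      _ = _ := by rw [hCC, mul_one, mul_one]

end RealLog

/-! ### Monodromy matrices and Floquet factorizations. -/

variable {n : ℕ} {A : ℝ → Matrix (Fin n) (Fin n) ℝ} {T : ℝ}

theorem IsFundamentalMatrixSolution.exists_eq_mul (hA : Continuous A)
    {Φ Ψ : ℝ → Matrix (Fin n) (Fin n) ℝ} (hΦ : IsFundamentalMatrixSolution A Φ)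
    (hΨ : ∀ t, HasDerivAt Ψ (A t * Ψ t) t) : ∀ t, Ψ t = Φ t * ((Φ 0)⁻¹ * Ψ 0) := by
  obtain ⟨Φ₀, -, -, h⟩ := exists_fundamental_and_unique hA
  intro t
  have h0 := (Matrix.isUnit_iff_isUnit_det _).1 (hΦ.2 0)
  rw [h Ψ hΨ t, h Φ hΦ.1 t, mul_assoc, ← mul_assoc (Φ 0), Matrix.mul_nonsing_inv _ h0, one_mul]

/-- By periodicity of `A`, the translate `s ↦ Φ (s + T)` is again a solution, hence a constant right
multiple of `Φ`. -/
theorem IsFundamentalMatrixSolution.add_period (hA : Continuous A) (hAT : Function.Periodic A T)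
    {Φ : ℝ → Matrix (Fin n) (Fin n) ℝ} (hΦ : IsFundamentalMatrixSolution A Φ) (t : ℝ) :
    Φ (t + T) = Φ t * monodromyMatrix Φ T := by
  have h := hΦ.exists_eq_mul hA (Ψ := fun s => Φ (s + T)) (fun s => by
    have h1 := hΦ.1 (s + T)
    rw [hAT] at h1
    open scoped Matrix.Norms.Operator in exact HasDerivAt.comp_add_const s T h1) t
  rw [monodromyMatrix]
  simpa only [zero_add] using h

theorem isUnit_monodromyMatrix {Φ : ℝ → Matrix (Fin n) (Fin n) ℝ}
    (hΦ : IsFundamentalMatrixSolution A Φ) : IsUnit (monodromyMatrix Φ T) :=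
  (Matrix.isUnit_nonsing_inv_iff.2 (hΦ.2 0)).mul (hΦ.2 T)

/-- Monodromy matrices of the same system are similar. -/
theorem monodromyMatrix_similar (hA : Continuous A)
    {Φ Ψ : ℝ → Matrix (Fin n) (Fin n) ℝ} (hΦ : IsFundamentalMatrixSolution A Φ)
    (hΨ : IsFundamentalMatrixSolution A Ψ) :
    ∃ C : Matrix (Fin n) (Fin n) ℝ, IsUnit C ∧
      monodromyMatrix Ψ T = C⁻¹ * monodromyMatrix Φ T * C := by
  have hC : IsUnit ((Φ 0)⁻¹ * Ψ 0) := (Matrix.isUnit_nonsing_inv_iff.2 (hΦ.2 0)).mul (hΨ.2 0)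
  refine ⟨_, hC, ?_⟩
  rw [monodromyMatrix, hΦ.exists_eq_mul hA hΨ.1 T, Matrix.mul_inv_rev,
    Matrix.nonsing_inv_nonsing_inv _ ((Matrix.isUnit_iff_isUnit_det _).1 (hΦ.2 0)), monodromyMatrix]
  have h0 : Φ 0 * (Φ 0)⁻¹ = 1 :=
    Matrix.mul_nonsing_inv _ ((Matrix.isUnit_iff_isUnit_det _).1 (hΦ.2 0))
  calc _ = (Ψ 0)⁻¹ * 1 * (Φ T * ((Φ 0)⁻¹ * Ψ 0)) := by rw [mul_one]
    _ = _ := by rw [← h0]; simp only [mul_assoc]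

/-- In `ℕ` the infimum of the empty set is also `0`; existence of a fundamental solution and of a
Jordan form excludes this case. -/
theorem isAIndex_zero_of_aIndex_eq_zero (hA : Continuous A) (h : aIndex A T = 0) :
    IsAIndex A T 0 := by
  obtain ⟨Φ, hΦ, -, -⟩ := exists_fundamental_and_unique hA
  obtain ⟨J, hJ⟩ := exists_isNormalFormOf (monodromyMatrix Φ T)
  have := Nat.sInf_mem (s := {d : ℕ | IsAIndex A T d}) ⟨_, Φ, J, hΦ, hJ, rfl⟩
  rwa [show sInf {d : ℕ | IsAIndex A T d} = 0 from h] at this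

theorem periodic_factor_of_exp_eq_monodromyMatrix (hA : Continuous A)
    (hAT : Function.Periodic A T) {Φ : ℝ → Matrix (Fin n) (Fin n) ℝ}
    (hΦ : IsFundamentalMatrixSolution A Φ) {B : Matrix (Fin n) (Fin n) ℝ}
    (hB : NormedSpace.exp (T • B) = monodromyMatrix Φ T) :
    ∃ P : ℝ → Matrix (Fin n) (Fin n) ℝ, Function.Periodic P T ∧
      ∀ t : ℝ, Φ t = P t * NormedSpace.exp (t • B) := by
  have hadd : ∀ s t : ℝ, NormedSpace.exp ((s + t) • B) =
      NormedSpace.exp (s • B) * NormedSpace.exp (t • B) := fun s t => by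
    rw [add_smul]
    exact Matrix.exp_add_of_commute _ _ (((Commute.refl B).smul_left s).smul_right t)
  refine ⟨fun t => Φ t * NormedSpace.exp ((-t) • B), fun t => ?_, fun t => ?_⟩
  · simp only
    rw [hΦ.add_period hA hAT, ← hB, mul_assoc, ← hadd]
    congr 3
    ring
  · simp only
    rw [mul_assoc, ← hadd, neg_add_cancel, zero_smul, NormedSpace.exp_zero, mul_one]

theorem monodromyMatrix_of_periodic_factor {Q : ℝ → Matrix (Fin n) (Fin n) ℝ}
    (hQ : Function.Periodic Q T) {R : Matrix (Fin n) (Fin n) ℝ}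
    (h0 : IsUnit (Q 0 * NormedSpace.exp ((0 : ℝ) • R))) :
    monodromyMatrix (fun t => Q t * NormedSpace.exp (t • R)) T = NormedSpace.exp (T • R) := by
  rw [zero_smul, NormedSpace.exp_zero, mul_one] at h0
  have hT : Q T = Q 0 := by simpa using hQ 0
  rw [monodromyMatrix, zero_smul, NormedSpace.exp_zero, mul_one, hT, ← mul_assoc,
    Matrix.nonsing_inv_mul _ ((Matrix.isUnit_iff_isUnit_det _).1 h0), one_mul]

end Floquet

theorem mainTheorem2 (n : ℕ) (T : ℝ) (hT : 0 < T) (A : ℝ → Matrix (Fin n) (Fin n) ℝ)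
    (hA : Continuous A) (hAT : Function.Periodic A T) :
    List.TFAE [
      Floquet.aIndex A T = 0,
      ∃ (R : Matrix (Fin n) (Fin n) ℝ) (Q : ℝ → Matrix (Fin n) (Fin n) ℝ),
        Function.Periodic Q T ∧
          Floquet.IsFundamentalMatrixSolution A (fun t => Q t * NormedSpace.exp (t • R)),
      ∀ Φ : ℝ → Matrix (Fin n) (Fin n) ℝ, Floquet.IsFundamentalMatrixSolution A Φ →
        ∃ (B : Matrix (Fin n) (Fin n) ℝ) (P : ℝ → Matrix (Fin n) (Fin n) ℝ),
          Function.Periodic P T ∧ ∀ t : ℝ, Φ t = P t * NormedSpace.exp (t • B)] := by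
  tfae_have 1 → 3 := by
    intro h Φ hΦ
    obtain ⟨Φ', J, hΦ', hJ, h0⟩ := Floquet.isAIndex_zero_of_aIndex_eq_zero hA h
    obtain ⟨C, hC, hCM⟩ := Floquet.monodromyMatrix_similar (T := T) hA hΦ' hΦ
    have hJ' := hJ.similar hC
    rw [← hCM] at hJ'
    obtain ⟨B, hB⟩ := hJ'.exists_real_log (Floquet.isUnit_monodromyMatrix hΦ) h0.symm
    obtain ⟨P, hP⟩ := Floquet.periodic_factor_of_exp_eq_monodromyMatrix hA hAT hΦ
      (B := T⁻¹ • B) (by rw [smul_inv_smul₀ hT.ne', hB])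
    exact ⟨_, P, hP⟩
  tfae_have 3 → 2 := by
    intro h
    obtain ⟨Φ, hΦ, -, -⟩ := Floquet.exists_fundamental_and_unique hA
    obtain ⟨B, P, hP, hΦP⟩ := h Φ hΦ
    exact ⟨B, P, hP, funext hΦP ▸ hΦ⟩
  tfae_have 2 → 1 := by
    rintro ⟨R, Q, hQ, hΨ⟩
    obtain ⟨J, hJ⟩ := Floquet.exists_isNormalFormOf
      (Floquet.monodromyMatrix (fun t => Q t * NormedSpace.exp (t • R)) T)
    -- As the index is an infimum, a single normal form with value `0` suffices, and uniqueness of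
    -- the Jordan form is not needed.
    refine Nat.eq_zero_of_le_zero (Nat.sInf_le ⟨_, J, hΨ, hJ, ?_⟩)
    -- Half a period supplies the real square root of the monodromy matrix.
    have hsq : NormedSpace.exp (T • R) =
        NormedSpace.exp ((T / 2) • R) * NormedSpace.exp ((T / 2) • R) := by
      rw [← Matrix.exp_add_of_commute _ _ (Commute.refl _), ← add_smul, add_halves]
    rw [Floquet.monodromyMatrix_of_periodic_factor hQ (hΨ.2 0), hsq] at hJ
    exact (J.oddNegativeDim_eq_zero_iff.2 fun m r hr => hJ.even_multiplicity_of_mul_self hr m).symm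
  tfae_finish
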